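/- A negation normal form (NNF) circuit $C$ on a set of variables $X$ is a finite directed acyclic graph with a distinguished output gate $o$, in which every gate of in-degree $0$ (an input) is labelled by $0$, $1$ or a literal $x$ or $\neg x$ with $x \in X$, and every other gate is labelled by $\wedge$ or $\vee$. For a gate $g$, let $\mathrm{var}(g)$ be the set of variables $x$ such that there is a path from an input labelled $x$ or $\neg x$ to $g$. $C$ is a DNNF if for every $\wedge$-gate $g$ and all distinct gates $h,h'$ with edges $(h,g)$, $(h',g)$ we have $\mathrm{var}(h)\cap\mathrm{var}(h')=\emptyset$. Let $E$ be the set of edges of $C$, and let $\mathrm{in}(g)$ and $\mathrm{out}(g)$ be the sets of edges going into and out of $g$. Let $S_y(C)$ be the following system in the variables $y\in\mathbb R^{E}$: \begin{align*} \sum_{e\in \mathrm{in}(o)} y_e &= 1,\\ \sum_{e\in \mathrm{in}(g)} y_e-\sum_{f\in \mathrm{out}(g)} y_f &= 0 && \text{for every $\vee$-gate } g\ne o,\\ y_e-\sum_{f\in \mathrm{out}(g)} y_f &= 0 && \text{for every $\wedge$-gate } g \text{ and } e\in \mathrm{in}(g),\\ y_e &\ge 0 && \text{for every } e\in E, \end{align*}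 and let $P_y(C)\subseteq\mathbb R^{E}$ be its set of solutions. A rational system $Ay=b,\ y\ge 0$ is totally dual integral (TDI) if for every integral vector $c$ for which $\min\{z^{\mathsf T}b : zA\ge c\}$ is finite, this minimum (over real $z$) is attained by an integral vector $z$. A rational polyhedron is integral if it is the convex hull of its integral points. Theorem. For every DNNF circuit $C$, the system $S_y(C)$ is TDI and the polyhedron $P_y(C)$ is integral. Moreover, the matrix of the equality constraints of $S_y(C)$ need not be totally unimodular: there is a DNNF circuit $C$ for which it is not. Such a $C$ can be chosen smooth (that is, $\mathrm{var}(h)=\mathrm{var}(g)$ for every edge $(h,g)$ into a $\vee$-gate $g$), with the output a $\vee$-gate without outgoing edges, with a path from every gate to the output, and with at most one input labelled by each literal. -/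

import Mathlib

/-! ### Linear systems `A y = b, y ≥ 0` -/

/-- The polyhedron `{y : A y = b, y ≥ 0}` of real solutions of a rational system. -/
def stdPolyhedron {ι κ : Type*} [Fintype κ] (A : Matrix ι κ ℚ) (b : ι → ℚ) : Set (κ → ℝ) :=
  {y | (A.map (fun q : ℚ => (q : ℝ))).mulVec y = (fun i => (b i : ℝ)) ∧ ∀ e, 0 ≤ y e}

/-- The feasible region `{z : z A ≥ c}` of the linear program `min {zᵀ b : z A ≥ c}`, which is
the dual of `max {cᵀ y : A y = b, y ≥ 0}`. -/
def dualRegion {ι κ : Type*} [Fintype ι] (A : Matrix ι κ ℚ) (c : κ → ℤ) : Set (ι → ℝ) :=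
  {z | ∀ e, (c e : ℝ) ≤ Matrix.vecMul z (A.map (fun q : ℚ => (q : ℝ))) e}

/-- The set of objective values `zᵀ b` of the dual linear program `min {zᵀ b : z A ≥ c}`. -/
def dualValues {ι κ : Type*} [Fintype ι] (A : Matrix ι κ ℚ) (b : ι → ℚ) (c : κ → ℤ) : Set ℝ :=
  (fun z : ι → ℝ => ∑ i, z i * (b i : ℝ)) '' dualRegion A c

/-- Total dual integrality of the rational system `A y = b, y ≥ 0`: for each integral `c` for
which `min {zᵀ b : z A ≥ c}` is finite, this minimum is attained by an integral `z`. -/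
def IsTDI {ι κ : Type*} [Fintype ι] (A : Matrix ι κ ℚ) (b : ι → ℚ) : Prop :=
  ∀ c : κ → ℤ, (dualValues A b c).Nonempty → BddBelow (dualValues A b c) →
    ∃ z : ι → ℤ, (fun i => (z i : ℝ)) ∈ dualRegion A c ∧
      IsLeast (dualValues A b c) (∑ i, (z i : ℝ) * (b i : ℝ))

/-- A (rational) polyhedron is integral if it is the convex hull of its integral points. -/
def IsIntegralPolyhedron {κ : Type*} (P : Set (κ → ℝ)) : Prop :=
  P = convexHull ℝ {y | y ∈ P ∧ ∀ e, ∃ k : ℤ, y e = (k : ℝ)}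

/-! ### Circuits -/

/-- Labels of the gates of a circuit on variables `X`: the constants `0` and `1`, the literals
(`lit x true` is `x`, `lit x false` is `¬ x`), and the connectives. -/
inductive GateLabel (X : Type*) where
  | const (b : Bool) : GateLabel X
  | lit (x : X) (b : Bool) : GateLabel X
  | and : GateLabel X
  | or : GateLabel X

/-- A label that only inputs carry, that is, a constant or a literal. -/
def GateLabel.IsInput {X : Type*} : GateLabel X → Prop
  | .const _ => True
  | .lit _ _ => True
  | .and => False
  | .or => False

/-- Negation normal form circuits on variables `X` with set of gates `V` (finite in all uses):
labelled directed acyclic graphs with a distinguished output gate, whose gates of in-degree `0`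
are labelled by constants or literals and whose other gates are labelled by `∧` or `∨`. -/
structure NNF (X V : Type*) where
  graph : Digraph V
  acyclic : ∀ g, ¬ Relation.TransGen graph.Adj g g
  out : V
  label : V → GateLabel X
  isInput_iff : ∀ g, (label g).IsInput ↔ ∀ h, ¬ graph.Adj h g

namespace NNF

variable {X V : Type*}

/-- The variables below `g`: those `x` such that there is a path (possibly of length `0`) from an
input labelled by `x` or `¬ x` to `g`. -/
def vars (C : NNF X V) (g : V) : Set X :=
  {x | ∃ h b, C.label h = .lit x b ∧ Relation.ReflTransGen C.graph.Adj h g}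

/-- A circuit is a DNNF if each `∧`-gate is decomposable: its distinct inputs have disjoint sets
of variables. -/
def IsDNNF (C : NNF X V) : Prop :=
  ∀ g, C.label g = .and → ∀ h h', C.graph.Adj h g → C.graph.Adj h' g → h ≠ h' →
    Disjoint (C.vars h) (C.vars h')

/-- A circuit is smooth if each input of a `∨`-gate `g` has the same variables as `g`. -/
def IsSmooth (C : NNF X V) : Prop :=
  ∀ g, C.label g = .or → ∀ h, C.graph.Adj h g → C.vars g = C.vars h

/-- A circuit is normalized if it is smooth, its output is a `∨`-gate with no outgoing edges,
there is a path from every gate to the output, and no two inputs carry the same literal. -/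
structure IsNormalized (C : NNF X V) : Prop where
  smooth : C.IsSmooth
  out_or : C.label C.out = .or
  out_sink : ∀ g, ¬ C.graph.Adj C.out g
  reaches_out : ∀ g, Relation.ReflTransGen C.graph.Adj g C.out
  lit_unique : ∀ g h x b, C.label g = .lit x b → C.label h = .lit x b → g = h

/-- The edges of a circuit, directed from `src` to `tgt`. -/
@[ext]
structure Edge (C : NNF X V) where
  src : V
  tgt : V
  adj : C.graph.Adj src tgt

/-- The equality constraints of the system `S_y(C)`: one for the output, one for each `∨`-gate
other than the output, one for each edge going into an `∧`-gate. -/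
inductive Row (C : NNF X V) where
  | output : Row C
  | or (g : V) (hg : C.label g = .or) (hne : g ≠ C.out) : Row C
  | and (e : Edge C) (he : C.label e.tgt = .and) : Row C

instance [Finite V] (C : NNF X V) : Finite (Edge C) :=
  Finite.of_injective (fun e : Edge C => (e.src, e.tgt)) (by
    intro e f h
    simp only [Prod.mk.injEq] at h
    exact Edge.ext h.1 h.2)

instance [Finite V] (C : NNF X V) : Finite (Row C) :=
  Finite.of_injective
    (fun r : Row C => match r with
      | .output => (none : Option (V ⊕ Edge C))
      | .or g _ _ => some (Sum.inl g)
      | .and e _ => some (Sum.inr e)) (by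
    intro r s h
    cases r <;> cases s <;> simp_all)

noncomputable instance [Finite V] (C : NNF X V) : Fintype (Edge C) := Fintype.ofFinite _

noncomputable instance [Finite V] (C : NNF X V) : Fintype (Row C) := Fintype.ofFinite _

open Classical in
/-- The matrix of the equality constraints of `S_y(C)`. -/
noncomputable def sysMatrix (C : NNF X V) : Matrix (Row C) (Edge C) ℚ
  | .output, f => if f.tgt = C.out then 1 else 0
  | .or g _ _, f => (if f.tgt = g then 1 else 0) - (if f.src = g then 1 else 0)
  | .and e _, f => (if f = e then 1 else 0) - (if f.src = e.tgt then 1 else 0)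

/-- The right-hand side of the equality constraints of `S_y(C)`. -/
def sysRhs (C : NNF X V) : Row C → ℚ
  | .output => 1
  | .or _ _ _ => 0
  | .and _ _ => 0

/-- The polyhedron `P_y(C)` of the solutions of the system `S_y(C)`. -/
noncomputable def polyhedron [Finite V] (C : NNF X V) : Set (Edge C → ℝ) :=
  stdPolyhedron C.sysMatrix C.sysRhs

open Classical in
/-- The system `S_y(C)` written out. -/
theorem mem_polyhedron_iff [Finite V] (C : NNF X V) (y : Edge C → ℝ) :
    y ∈ C.polyhedron ↔
      (∑ e with e.tgt = C.out, y e = 1) ∧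
      (∀ g, C.label g = .or → g ≠ C.out →
        ∑ e with e.tgt = g, y e - ∑ f with f.src = g, y f = 0) ∧
      (∀ g, C.label g = .and → ∀ e : Edge C, e.tgt = g → y e - ∑ f with f.src = g, y f = 0) ∧
      (∀ e, 0 ≤ y e) := by
  have key : ∀ r : Row C, (C.sysMatrix.map (fun q : ℚ => (q : ℝ))).mulVec y r =
      match r with
      | .output => ∑ e with e.tgt = C.out, y e
      | .or g _ _ => ∑ e with e.tgt = g, y e - ∑ f with f.src = g, y f
      | .and e _ => y e - ∑ f with f.src = e.tgt, y f := by
    intro r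
    cases r <;>
      simp [Matrix.mulVec, dotProduct, sysMatrix, sub_mul, Finset.sum_filter,
        apply_ite (fun q : ℚ => (q : ℝ))]
  constructor
  · rintro ⟨h, h0⟩
    refine ⟨?_, ?_, ?_, h0⟩
    · simpa [key, sysRhs] using congrFun h .output
    · intro g hg hne
      simpa [key, sysRhs] using congrFun h (.or g hg hne)
    · rintro g hg e rfl
      simpa [key, sysRhs] using congrFun h (.and e hg)
  · rintro ⟨h1, h2, h3, h0⟩
    refine ⟨?_, h0⟩
    funext r
    rw [key]
    cases r with
    | output => simpa [sysRhs] using h1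
    | or g hg hne => simpa [sysRhs] using h2 g hg hne
    | and e he => simpa [sysRhs] using h3 _ he e rfl

end NNF

/-! Maximizing a linear objective `c` over `P_y(C)` is dynamic programming. Bottom-up, `W g` is the
best weight of one unit of flow leaving `g`: the terms `c e + W e.src` of the incoming edges are
added at an ∧-gate and maximized at a ∨-gate; `K` is the value at the output. Read as multipliers of
the rows, these numbers form a dual feasible vector of objective `K`, integral when `c` is
(`IsPotential.le_vecMul`). Keeping one maximizing edge into each ∨-gate and pushing one unit down
from the output gives an integral point of `P_y(C)` supported on tight dual constraints
(`IsSelection.exists_flow`, `IsPotential.exists_selection`). By complementary slackness both are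
optimal, which is TDI. As there are finitely many selections, separating a point from the hull of
their flows gives integrality.

If the output is not a ∨-gate, every `K` is dual feasible, so the dual is unbounded and the
polyhedron is empty.

Total unimodularity fails through a cyclic 7 × 7 submatrix of determinant 2. -/

namespace NNF

variable {X V : Type*}

/-! ### Recursion along a finite acyclic circuit -/

theorem wellFounded_adj [Finite V] (C : NNF X V) : WellFounded C.graph.Adj := by
  have : Std.Irrefl (Relation.TransGen C.graph.Adj) := ⟨C.acyclic⟩
  exact Subrelation.wf Relation.TransGen.single
    (Finite.wellFounded_of_trans_of_irrefl (Relation.TransGen C.graph.Adj))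

theorem wellFounded_adj_swap [Finite V] (C : NNF X V) :
    WellFounded (fun g h => C.graph.Adj h g) := by
  have : Std.Irrefl (Relation.TransGen C.graph.Adj) := ⟨C.acyclic⟩
  have : Std.Irrefl (Function.swap (Relation.TransGen C.graph.Adj)) := ⟨fun g => C.acyclic g⟩
  exact Subrelation.wf (r := Function.swap (Relation.TransGen C.graph.Adj))
    Relation.TransGen.single
    (Finite.wellFounded_of_trans_of_irrefl (Function.swap (Relation.TransGen C.graph.Adj)))

theorem Edge.adj_of_tgt_eq {C : NNF X V} (e : Edge C) {g : V} (h : e.tgt = g) :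
    C.graph.Adj e.src g :=
  h ▸ e.adj

theorem Edge.adj_of_src_eq {C : NNF X V} (e : Edge C) {g : V} (h : e.src = g) :
    C.graph.Adj g e.tgt :=
  h ▸ e.adj

theorem label_tgt (C : NNF X V) (e : Edge C) : C.label e.tgt = .and ∨ C.label e.tgt = .or := by
  have h : ¬ (C.label e.tgt).IsInput := fun h => (C.isInput_iff _).1 h _ e.adj
  cases hl : C.label e.tgt <;> simp_all [GateLabel.IsInput]

theorem exists_edge_of_or (C : NNF X V) {g : V} (hg : C.label g = .or) :
    ∃ e : Edge C, e.tgt = g := by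
  have h : ¬ (C.label g).IsInput := by simp [hg, GateLabel.IsInput]
  rw [C.isInput_iff] at h
  push Not at h
  obtain ⟨h, hh⟩ := h
  exact ⟨⟨h, g, hh⟩, rfl⟩

/-! ### Dual solutions from potentials -/

/-- The dual vector with value `K` at the output row, `W` at the `∨`-rows, `M` at the `∧`-rows. -/
def dualVec {R : Type*} (C : NNF X V) (K : R) (W : V → R) (M : Edge C → R) : Row C → R
  | .output => K
  | .or g _ _ => W g
  | .and e _ => M e

open Classical in
/-- Bottom-up potentials of the gates for edge weights `c`: sums at `∧`-gates, maxima at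
`∨`-gates. The output carries the value `K` as a target of edges and, if it is a `∨`-gate, the
potential `0` as a source of edges. -/
structure IsPotential {R : Type*} [CommRing R] [LinearOrder R] [Finite V] (C : NNF X V)
    (c : Edge C → R) (K : R) (W : V → R) : Prop where
  or_le : ∀ e : Edge C, C.label e.tgt = .or → e.tgt ≠ C.out → c e + W e.src ≤ W e.tgt
  or_eq : ∀ g, C.label g = .or → g ≠ C.out → ∃ e : Edge C, e.tgt = g ∧ c e + W e.src = W g
  out_le : ∀ e : Edge C, C.label e.tgt = .or → e.tgt = C.out → c e + W e.src ≤ K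
  out_eq : C.label C.out = .or → ∃ e : Edge C, e.tgt = C.out ∧ c e + W e.src = K
  and_eq : ∀ g, C.label g = .and →
    W g = ∑ e with e.tgt = g, (c e + W e.src - if e.tgt = C.out then K else 0)
  eq_zero : ∀ g, C.label g ≠ .and → ¬ (C.label g = .or ∧ g ≠ C.out) → W g = 0

section Potential

variable {R : Type*} [CommRing R] [LinearOrder R] [Finite V] (C : NNF X V)

open Classical in
-- Well-founded recursion from the inputs upwards. `K` is a free parameter here: it enters only when
-- the output is an ∧-gate.
theorem exists_potential_aux (c : Edge C → R) (K : R) : ∃ W : V → R,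
    (∀ e : Edge C, C.label e.tgt = .or → e.tgt ≠ C.out → c e + W e.src ≤ W e.tgt) ∧
    (∀ g, C.label g = .or → g ≠ C.out → ∃ e : Edge C, e.tgt = g ∧ c e + W e.src = W g) ∧
    (∀ g, C.label g = .and →
      W g = ∑ e with e.tgt = g, (c e + W e.src - if e.tgt = C.out then K else 0)) ∧
    (∀ g, C.label g ≠ .and → ¬ (C.label g = .or ∧ g ≠ C.out) → W g = 0) := by
  let F : ∀ g : V, (∀ h, C.graph.Adj h g → R) → R := fun g ih =>
    if hg : C.label g = .or ∧ g ≠ C.out then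
      haveI : Nonempty {e : Edge C // e.tgt = g} :=
        let ⟨e, he⟩ := C.exists_edge_of_or hg.1; ⟨⟨e, he⟩⟩
      Finset.univ.sup' Finset.univ_nonempty
        (fun e : {e : Edge C // e.tgt = g} => c e.1 + ih e.1.src (e.1.adj_of_tgt_eq e.2))
    else if C.label g = .and then
      -- Edges into the output already receive `K` from the output row, so an ∧-output has to
      -- subtract it.
      ∑ e : {e : Edge C // e.tgt = g},
        (c e.1 + ih e.1.src (e.1.adj_of_tgt_eq e.2) - if e.1.tgt = C.out then K else 0)
    else 0
  let W := C.wellFounded_adj.fix F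
  have hW : ∀ g, W g = F g (fun h _ => W h) := fun g => C.wellFounded_adj.fix_eq F g
  refine ⟨W, ?_, ?_, ?_, ?_⟩
  · intro e he hne
    rw [hW e.tgt]
    simp only [F]
    rw [dif_pos ⟨he, hne⟩]
    exact Finset.le_sup' (fun e' : {e' : Edge C // e'.tgt = e.tgt} => c e'.1 + W e'.1.src)
      (Finset.mem_univ ⟨e, rfl⟩)
  · intro g hg hne
    rw [hW g]
    simp only [F]
    rw [dif_pos ⟨hg, hne⟩]
    have : Nonempty {e : Edge C // e.tgt = g} :=
      let ⟨e, he⟩ := C.exists_edge_of_or hg; ⟨⟨e, he⟩⟩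
    obtain ⟨e, -, he⟩ := Finset.exists_mem_eq_sup' Finset.univ_nonempty
      (fun e : {e : Edge C // e.tgt = g} => c e.1 + W e.1.src)
    exact ⟨e.1, e.2, he.symm⟩
  · intro g hg
    rw [hW g]
    simp only [F]
    rw [dif_neg (by simp [hg]), if_pos hg]
    exact (Finset.sum_subtype _ (by simp)
      (fun e : Edge C => c e + W e.src - if e.tgt = C.out then K else 0)).symm
  · intro g h1 h2
    rw [hW g]
    simp only [F]
    rw [dif_neg h2, if_neg h1]

theorem exists_isPotential_of_not_or (ho : C.label C.out ≠ .or) (c : Edge C → R) (K : R) :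
    ∃ W, IsPotential C c K W := by
  obtain ⟨W, h1, h2, h3, h4⟩ := C.exists_potential_aux c K
  exact ⟨W, h1, h2, fun e he h => absurd (h ▸ he) ho, fun h => absurd h ho, h3, h4⟩

theorem exists_isPotential_of_or (ho : C.label C.out = .or) (c : Edge C → R) :
    ∃ K W, IsPotential C c K W := by
  classical
  -- For a ∨-output the potentials do not involve `K`, so the 0 is a dummy and `K` is chosen
  -- afterwards as the maximum over the edges into the output.
  obtain ⟨W, h1, h2, h3, h4⟩ := C.exists_potential_aux c 0
  obtain ⟨e₀, he₀⟩ := C.exists_edge_of_or ho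
  obtain ⟨e, he, hmax⟩ := (Finset.univ.filter (fun e : Edge C => e.tgt = C.out)).exists_max_image
    (fun e => c e + W e.src) ⟨e₀, by simpa using he₀⟩
  refine ⟨c e + W e.src, W, h1, h2, fun f _ hf => hmax f (by simpa using hf),
    fun _ => ⟨e, by simpa using he, rfl⟩, fun g hg => ?_, h4⟩
  rw [h3 g hg]
  refine Finset.sum_congr rfl fun f hf => ?_
  have hne : f.tgt ≠ C.out := by
    rintro h
    rw [(Finset.mem_filter.1 hf).2] at h
    rw [h, ho] at hg
    cases hg
  simp [hne]

end Potential

theorem IsPotential.intCast [Finite V] {C : NNF X V} {c : Edge C → ℤ} {K : ℤ} {W : V → ℤ}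
    (h : IsPotential C c K W) :
    IsPotential C (fun e => (c e : ℝ)) (K : ℝ) (fun g => (W g : ℝ)) where
  or_le e h1 h2 := by exact_mod_cast h.or_le e h1 h2
  or_eq g h1 h2 := by exact_mod_cast h.or_eq g h1 h2
  out_le e h1 h2 := by exact_mod_cast h.out_le e h1 h2
  out_eq h1 := by exact_mod_cast h.out_eq h1
  and_eq g hg := by
    have := h.and_eq g hg
    push_cast [this, apply_ite (fun n : ℤ => (n : ℝ))]
    rfl
  eq_zero g h1 h2 := by exact_mod_cast h.eq_zero g h1 h2

open Classical in
-- Splits by kind of row; `G` and `H` are total, which removes the label proofs carried by the rows.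
theorem sum_row [Finite V] (C : NNF X V) (F : Row C → ℝ) (G : V → ℝ) (H : Edge C → ℝ)
    (hG : ∀ g hg hne, F (.or g hg hne) = G g) (hH : ∀ e he, F (.and e he) = H e) :
    ∑ r, F r = F .output + (∑ᶠ g, if C.label g = .or ∧ g ≠ C.out then G g else 0) +
      ∑ e, if C.label e.tgt = .and then H e else 0 := by
  have := Fintype.ofFinite V
  let φ : Unit ⊕ {g // C.label g = .or ∧ g ≠ C.out} ⊕ {e : Edge C // C.label e.tgt = .and} →
      Row C
    | .inl _ => .output
    | .inr (.inl g) => .or g.1 g.2.1 g.2.2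
    | .inr (.inr e) => .and e.1 e.2
  have hφ : Function.Bijective φ := by
    constructor
    · rintro (_ | ⟨g, hg⟩ | ⟨e, he⟩) (_ | ⟨g', hg'⟩ | ⟨e', he'⟩) h <;> simp_all [φ]
    · rintro (_ | ⟨g, hg, hne⟩ | ⟨e, he⟩)
      · exact ⟨.inl (), rfl⟩
      · exact ⟨.inr (.inl ⟨g, hg, hne⟩), rfl⟩
      · exact ⟨.inr (.inr ⟨e, he⟩), rfl⟩
  rw [← Function.Bijective.sum_comp hφ F, finsum_eq_sum_of_fintype, Fintype.sum_sum_type,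
    Fintype.sum_sum_type, ← Finset.sum_filter, ← Finset.sum_filter, ← add_assoc]
  congr 1
  · congr 1
    · simp [φ]
    · rw [Finset.sum_subtype _ (p := fun g => C.label g = .or ∧ g ≠ C.out) (by simp)]
      exact Finset.sum_congr rfl fun g _ => hG _ _ _
  · rw [Finset.sum_subtype _ (p := fun e : Edge C => C.label e.tgt = .and) (by simp)]
    exact Finset.sum_congr rfl fun e _ => hH _ _

open Classical in
theorem vecMul_dualVec [Finite V] (C : NNF X V) (K : ℝ) (W : V → ℝ) (M : Edge C → ℝ)
    (f : Edge C) :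
    Matrix.vecMul (C.dualVec K W M) (C.sysMatrix.map (fun q : ℚ => (q : ℝ))) f =
      ((if f.tgt = C.out then K else 0) +
        (if C.label f.tgt = .or ∧ f.tgt ≠ C.out then W f.tgt else 0) +
        (if C.label f.tgt = .and then M f else 0)) -
      ((if C.label f.src = .or ∧ f.src ≠ C.out then W f.src else 0) +
        (if C.label f.src = .and then ∑ e with e.tgt = f.src, M e else 0)) := by
  have := Fintype.ofFinite V
  have h1 : ∀ a : V, (∑ g, if C.label g = .or ∧ g ≠ C.out then
      W g * (if a = g then 1 else 0) else 0) =
      if C.label a = .or ∧ a ≠ C.out then W a else 0 := by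
    intro a
    rw [Finset.sum_eq_single a] <;> simp +contextual [eq_comm]
  have h2 : (∑ e : Edge C, if C.label e.tgt = .and then
      M e * (if f = e then 1 else 0) else 0) = if C.label f.tgt = .and then M f else 0 := by
    rw [Finset.sum_eq_single f] <;> simp +contextual [eq_comm]
  have h3 : (∑ e : Edge C, if C.label e.tgt = .and then
      M e * (if f.src = e.tgt then 1 else 0) else 0) =
      if C.label f.src = .and then ∑ e with e.tgt = f.src, M e else 0 := by
    rw [Finset.sum_filter]
    split_ifs with h
    · refine Finset.sum_congr rfl fun e _ => ?_
      by_cases he : e.tgt = f.src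
      · simp [he, h]
      · simp [he, Ne.symm he]
    · refine Finset.sum_eq_zero fun e _ => ?_
      by_cases he : e.tgt = f.src
      · simp [he, h]
      · simp [Ne.symm he]
  rw [Matrix.vecMul, dotProduct, C.sum_row _
    (fun g => W g * (if f.tgt = g then 1 else 0) - W g * (if f.src = g then 1 else 0))
    (fun e => M e * (if f = e then 1 else 0) - M e * (if f.src = e.tgt then 1 else 0))
    (by intro g hg hne; simp [dualVec, sysMatrix, mul_sub, apply_ite (fun q : ℚ => (q : ℝ))])
    (by intro e he; simp [dualVec, sysMatrix, mul_sub, apply_ite (fun q : ℚ => (q : ℝ))]), finsum_eq_sum_of_fintype]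
  have e1 : ∀ (p : Prop) [Decidable p] (a b : ℝ),
      (if p then a - b else 0) = (if p then a else 0) - (if p then b else 0) := by
    intros; split_ifs <;> simp
  simp only [e1, Finset.sum_sub_distrib, h1, h2, h3]
  simp only [dualVec, sysMatrix, Matrix.map_apply]
  split_ifs <;> simp <;> ring

section Dual

variable [Finite V] {C : NNF X V}

open Classical in
/-- The dual vector given by potentials. -/
noncomputable def potentialDual {R : Type*} [CommRing R] (C : NNF X V) (c : Edge C → R) (K : R)
    (W : V → R) : Row C → R :=
  C.dualVec K W (fun e => c e + W e.src - if e.tgt = C.out then K else 0)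

open Classical in
theorem IsPotential.vecMul_eq {c : Edge C → ℝ} {K : ℝ} {W : V → ℝ} (h : IsPotential C c K W)
    (f : Edge C) :
    Matrix.vecMul (C.potentialDual c K W) (C.sysMatrix.map (fun q : ℚ => (q : ℝ))) f =
      if C.label f.tgt = .and then c f else (if f.tgt = C.out then K else W f.tgt) - W f.src := by
  -- Whatever the label of the source, its rows charge exactly `W f.src`; at gates without such rows
  -- this is the convention `eq_zero`.
  have hs : ((if C.label f.src = .or ∧ f.src ≠ C.out then W f.src else 0) +
        (if C.label f.src = .and then ∑ e with e.tgt = f.src,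
          (c e + W e.src - if e.tgt = C.out then K else 0) else 0)) = W f.src := by
    by_cases h1 : C.label f.src = .and
    · simp [h1, h.and_eq _ h1]
    · by_cases h2 : C.label f.src = .or ∧ f.src ≠ C.out
      · simp [h2]
      · rw [h.eq_zero _ h1 h2]; simp [h1, h2]
  rw [potentialDual, vecMul_dualVec, hs]
  rcases C.label_tgt f with ht | ht <;> by_cases hf : f.tgt = C.out
  · have ho := hf ▸ ht
    simp [hf, ho]
  · simp [ht, hf]
  · have ho := hf ▸ ht
    simp [hf, ho]
  · simp [ht, hf]

theorem IsPotential.le_vecMul {c : Edge C → ℝ} {K : ℝ} {W : V → ℝ} (h : IsPotential C c K W)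
    (f : Edge C) :
    c f ≤ Matrix.vecMul (C.potentialDual c K W) (C.sysMatrix.map (fun q : ℚ => (q : ℝ))) f := by
  classical
  rw [h.vecMul_eq]
  rcases C.label_tgt f with ht | ht <;> by_cases hf : f.tgt = C.out
  · simp [ht]
  · simp [ht]
  · have := h.out_le f ht hf
    have ho := hf ▸ ht
    simp [hf, ho]; linarith
  · have := h.or_le f ht hf
    simp [ht, hf]; linarith

end Dual

/-! ### Weak duality -/

theorem sum_mul_sysRhs [Finite V] (C : NNF X V) (z : Row C → ℝ) :
    ∑ r, z r * (C.sysRhs r : ℝ) = z .output := by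
  rw [Finset.sum_eq_single Row.output]
  · simp [sysRhs]
  · rintro (_ | _ | _) - h <;> simp_all [sysRhs]
  · simp

theorem sum_vecMul_mul [Finite V] (C : NNF X V) {y : Edge C → ℝ} (hy : y ∈ C.polyhedron)
    (z : Row C → ℝ) :
    ∑ e, Matrix.vecMul z (C.sysMatrix.map (fun q : ℚ => (q : ℝ))) e * y e = z .output := by
  have h := Matrix.dotProduct_mulVec z (C.sysMatrix.map (fun q : ℚ => (q : ℝ))) y
  rw [hy.1] at h
  exact h.symm.trans (C.sum_mul_sysRhs z)

theorem sum_mul_le_of_mem_polyhedron [Finite V] (C : NNF X V) {y : Edge C → ℝ}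
    (hy : y ∈ C.polyhedron) {c : Edge C → ℝ} {z : Row C → ℝ}
    (hz : ∀ e, c e ≤ Matrix.vecMul z (C.sysMatrix.map (fun q : ℚ => (q : ℝ))) e) :
    ∑ e, c e * y e ≤ z .output := by
  rw [← C.sum_vecMul_mul hy z]
  exact Finset.sum_le_sum fun e _ => mul_le_mul_of_nonneg_right (hz e) (hy.2 e)

/-! ### Integral flows from selections -/

/-- A set of edges that contains exactly one edge into each `∨`-gate. -/
def IsSelection (C : NNF X V) (S : Set (Edge C)) : Prop :=
  ∀ g, C.label g = .or → ∃! e : Edge C, e.tgt = g ∧ e ∈ S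

/-- Keep the selected edges and all edges into ∧-gates. With `t g` the number of kept paths from `g`
to the output, a kept edge carries `t` of its target. Uniqueness of the selected edge gives
conservation at ∨-gates. -/
theorem IsSelection.exists_flow [Finite V] {C : NNF X V} (ho : C.label C.out = .or)
    {S : Set (Edge C)} (hS : C.IsSelection S) :
    ∃ y ∈ C.polyhedron, (∀ e, ∃ k : ℤ, y e = k) ∧
      ∀ e, y e ≠ 0 → C.label e.tgt = .or → e ∈ S := by
  classical
  let F : ∀ g : V, (∀ h, C.graph.Adj g h → ℕ) → ℕ := fun g ih =>
    if g = C.out then 1 else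
      ∑ f : {f : Edge C // f.src = g},
        if C.label f.1.tgt = .and ∨ f.1 ∈ S then ih f.1.tgt (f.1.adj_of_src_eq f.2) else 0
  let t := C.wellFounded_adj_swap.fix F
  have ht : ∀ g, t g = F g (fun h _ => t h) := fun g => C.wellFounded_adj_swap.fix_eq F g
  let y : Edge C → ℕ := fun f => if C.label f.tgt = .and ∨ f ∈ S then t f.tgt else 0
  have hout : t C.out = 1 := by rw [ht]; simp [F]
  have hsrc : ∀ g, g ≠ C.out → ∑ f with f.src = g, y f = t g := by
    intro g hg
    rw [ht g]
    simp only [F]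
    rw [if_neg hg]
    exact Finset.sum_subtype _ (by simp) y
  have htgt : ∀ g, C.label g = .or → ∑ e with e.tgt = g, y e = t g := by
    intro g hg
    obtain ⟨e, ⟨he, heS⟩, huniq⟩ := hS g hg
    rw [Finset.sum_eq_single e]
    · simp [y, heS, he]
    · intro f hf hne
      have hf' : f.tgt = g := by simpa using hf
      have : f ∉ S := fun h => hne (huniq f ⟨hf', h⟩)
      simp [y, this, hf', hg]
    · intro h; simp [he] at h
  refine ⟨fun e => (y e : ℝ), (C.mem_polyhedron_iff _).2 ⟨?_, ?_, ?_, ?_⟩, ?_, ?_⟩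
  · exact_mod_cast (htgt _ ho).trans hout
  · intro g hg hne
    rw [sub_eq_zero]
    exact_mod_cast (htgt g hg).trans (hsrc g hne).symm
  · rintro g hg e he
    have hne : g ≠ C.out := by
      rintro rfl
      rw [ho] at hg
      cases hg
    rw [sub_eq_zero]
    have : y e = t g := by simp [y, he, hg]
    exact_mod_cast this.trans (hsrc g hne).symm
  · intro e
    positivity
  · exact fun e => ⟨y e, by simp⟩
  · intro e h hor
    by_contra hS'
    exact h (by simp [y, hS', hor])

/-- Potentials determine a selection of edges at which the dual constraints are tight. -/
theorem IsPotential.exists_selection [Finite V] {C : NNF X V} (ho : C.label C.out = .or)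
    {c : Edge C → ℝ} {K : ℝ} {W : V → ℝ} (h : IsPotential C c K W) :
    ∃ S, C.IsSelection S ∧ ∀ f : Edge C, (C.label f.tgt = .or → f ∈ S) →
      Matrix.vecMul (C.potentialDual c K W) (C.sysMatrix.map (fun q : ℚ => (q : ℝ))) f = c f := by
  classical
  have key : ∀ g, C.label g = .or → ∃ e : Edge C, e.tgt = g ∧
      c e + W e.src = if g = C.out then K else W g := by
    intro g hg
    by_cases hne : g = C.out
    · subst hne
      simpa using h.out_eq ho
    · simpa [hne] using h.or_eq g hg hne
  choose! s hs1 hs2 using key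
  -- `s` also depends on the proof that the gate is a ∨-gate, so equal gates need a transport.
  have hcongr : ∀ g hg g' hg', g' = g → s g' hg' = s g hg := by
    rintro g hg _ _ rfl
    rfl
  refine ⟨{f | ∃ hf, s f.tgt hf = f}, fun g hg => ⟨s g hg, ⟨hs1 g hg, ?_, ?_⟩, ?_⟩, ?_⟩
  · rwa [hs1 g hg]
  · exact hcongr _ _ _ _ (hs1 g hg)
  · rintro f ⟨rfl, _, hfs⟩
    exact hfs.symm
  · intro f hf
    rw [h.vecMul_eq]
    rcases C.label_tgt f with ht | ht
    · simp [ht]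
    · have h2 := hs2 _ ht
      rw [(hf ht).2] at h2
      rw [← h2]
      simp [ht]

/-- Strong duality, with integral solutions coming from a selection. -/
theorem IsPotential.exists_selection_forall_flow [Finite V] {C : NNF X V}
    (ho : C.label C.out = .or) {c : Edge C → ℝ} {K : ℝ} {W : V → ℝ} (h : IsPotential C c K W) :
    ∃ S, C.IsSelection S ∧ ∀ y ∈ C.polyhedron,
      (∀ e, y e ≠ 0 → C.label e.tgt = .or → e ∈ S) → ∑ e, c e * y e = K := by
  obtain ⟨S, hS, htight⟩ := h.exists_selection ho
  refine ⟨S, hS, fun y hy hyS => ?_⟩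
  refine Eq.trans ?_ (C.sum_vecMul_mul hy (C.potentialDual c K W))
  refine Finset.sum_congr rfl fun e _ => ?_
  by_cases he : y e = 0
  · simp [he]
  · rw [htight e (hyS e he)]

/-! ### Total dual integrality and integrality -/

theorem polyhedron_eq_empty [Finite V] (C : NNF X V) (ho : C.label C.out ≠ .or) :
    C.polyhedron = ∅ := by
  refine Set.eq_empty_of_forall_notMem fun y hy => ?_
  -- Zero weights with the negative value `-1` turn weak duality into `0 ≤ -1`.
  obtain ⟨W, hW⟩ := C.exists_isPotential_of_not_or ho (0 : Edge C → ℝ) (-1)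
  have h : ∑ e, (0 : Edge C → ℝ) e * y e ≤ -1 := C.sum_mul_le_of_mem_polyhedron hy hW.le_vecMul
  norm_num at h

theorem isTDI_sys [Finite V] (C : NNF X V) : IsTDI C.sysMatrix C.sysRhs := by
  intro c _ hbdd
  have hdual : ∀ {K : ℤ} {W : V → ℤ}, IsPotential C c K W →
      (fun i => ((C.potentialDual c K W i : ℤ) : ℝ)) ∈ dualRegion C.sysMatrix c := by
    intro K W h e
    convert h.intCast.le_vecMul e using 2
    funext r
    cases r <;> simp [potentialDual, dualVec]
  by_cases ho : C.label C.out = .or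
  · obtain ⟨K, W, h⟩ := C.exists_isPotential_of_or ho c
    refine ⟨C.potentialDual c K W, hdual h, ⟨_, hdual h, rfl⟩, ?_⟩
    rintro _ ⟨z, hz, rfl⟩
    obtain ⟨S, hS, htight⟩ := h.intCast.exists_selection_forall_flow ho
    obtain ⟨y, hy, -, hyS⟩ := hS.exists_flow ho
    have hle := C.sum_mul_le_of_mem_polyhedron hy hz
    rw [htight y hy hyS] at hle
    rw [C.sum_mul_sysRhs fun r => ((C.potentialDual c K W r : ℤ) : ℝ)]
    exact hle.trans_eq (C.sum_mul_sysRhs z).symm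
  · exfalso
    obtain ⟨B, hB⟩ := hbdd
    obtain ⟨K, hK⟩ := exists_int_lt B
    obtain ⟨W, h⟩ := C.exists_isPotential_of_not_or ho c K
    refine hK.not_ge ((hB ⟨_, hdual h, rfl⟩).trans_eq ?_)
    exact C.sum_mul_sysRhs fun r => ((C.potentialDual c K W r : ℤ) : ℝ)

theorem convex_polyhedron [Finite V] (C : NNF X V) : Convex ℝ C.polyhedron := by
  intro x hx y hy a b ha hb hab
  refine ⟨?_, fun e => ?_⟩
  · rw [Matrix.mulVec_add, Matrix.mulVec_smul, Matrix.mulVec_smul, hx.1, hy.1, ← add_smul, hab,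
      one_smul]
  · exact add_nonneg (mul_nonneg ha (hx.2 e)) (mul_nonneg hb (hy.2 e))

theorem isIntegralPolyhedron_polyhedron [Finite V] (C : NNF X V) :
    IsIntegralPolyhedron C.polyhedron := by
  classical
  refine Set.Subset.antisymm ?_ (convexHull_min (fun y hy => hy.1) C.convex_polyhedron)
  by_cases ho : C.label C.out = .or
  · have hflow := fun S : {S // C.IsSelection S} => S.2.exists_flow ho
    choose y hyP hyZ hyS using hflow
    refine Set.Subset.trans (fun x hx => ?_) (convexHull_mono (s := Set.range y) ?_)
    · by_contra hx'
      -- The hull of finitely many selection flows is closed. The coefficients of a separating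
      -- functional serve as edge weights: some flow attains `K`, while weak duality bounds the
      -- value at `x` by `K`.
      obtain ⟨φ, u, hu, hux⟩ := geometric_hahn_banach_closed_point (convex_convexHull ℝ _)
        ((Set.finite_range y).isClosed_convexHull ℝ) hx'
      have hφ : ∀ v : Edge C → ℝ, φ v = ∑ e, φ (Pi.single e 1) * v e := by
        intro v
        have := LinearMap.pi_apply_eq_sum_univ (φ : (Edge C → ℝ) →ₗ[ℝ] ℝ) v
        refine this.trans (Finset.sum_congr rfl fun e _ => ?_)
        have hs : (fun j => if e = j then (1 : ℝ) else 0) = Pi.single e 1 := by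
          funext j
          simp [Pi.single_apply, eq_comm]
        rw [smul_eq_mul, mul_comm, hs]
        rfl
      obtain ⟨K, W, h⟩ := C.exists_isPotential_of_or ho fun e => φ (Pi.single e 1)
      obtain ⟨S, hS, htight⟩ := h.exists_selection_forall_flow ho
      have h1 := hu _ (subset_convexHull ℝ _ ⟨⟨S, hS⟩, rfl⟩)
      rw [hφ, htight _ (hyP _) (hyS ⟨S, hS⟩)] at h1
      have h2 := C.sum_mul_le_of_mem_polyhedron hx h.le_vecMul
      rw [← hφ] at h2
      exact absurd (h2 : φ x ≤ K) ((h1.trans hux).not_ge)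
    · rintro _ ⟨S, rfl⟩
      exact ⟨hyP S, hyZ S⟩
  · rw [C.polyhedron_eq_empty ho]
    exact Set.empty_subset _


/-! ### A circuit whose constraint matrix is not totally unimodular -/

/-- Acyclicity makes the local recursion determine the variable sets, so in a concrete circuit
reachability reduces to a finite check. -/
theorem vars_eq_of_forall [Finite V] (C : NNF X V) (s : V → Set X)
    (hs : ∀ g x, x ∈ s g ↔ (∃ b, C.label g = .lit x b) ∨ ∃ h, C.graph.Adj h g ∧ x ∈ s h) (g : V) :
    C.vars g = s g := by
  ext x
  constructor
  · rintro ⟨h, b, hl, hp⟩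
    induction hp with
    | refl => exact (hs _ _).2 (.inl ⟨b, hl⟩)
    | tail _ hadj ih => exact (hs _ _).2 (.inr ⟨_, hadj, ih⟩)
  · induction g using C.wellFounded_adj.induction with
    | _ g ih =>
      intro hx
      rcases (hs _ _).1 hx with ⟨b, hb⟩ | ⟨h, hadj, hxh⟩
      · exact ⟨g, b, hb, .refl⟩
      · obtain ⟨k, b, hl, hp⟩ := ih h hadj hxh
        exact ⟨k, b, hl, hp.tail hadj⟩

/-- The edges of `exampleNNF`, whose gates are `0 : x`, `1 : ¬ x`, `2 : y`, `3 : ¬ y`,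
`4 : x ∨ ¬ x`, `5 : y ∨ ¬ y`, `6 = 4 ∧ 5`, `7 = 4 ∧ y`, `8 = x ∧ 5`, `9 = 7 ∨ 8`, `10 = 9 ∨ 6`,
where `x` is `true` and `y` is `false`. -/
def exampleEdges : List (Fin 11 × Fin 11) :=
  [(0, 4), (1, 4), (2, 5), (3, 5), (4, 6), (5, 6), (4, 7), (2, 7), (0, 8), (5, 8), (7, 9), (8, 9),
    (9, 10), (6, 10)]

def exampleLabel : Fin 11 → GateLabel Bool :=
  ![.lit true true, .lit true false, .lit false true, .lit false false, .or, .or, .and, .and, .and,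
    .or, .or]

/-- The labels of gates as decidable data. -/
def labelCode {Y : Type*} : GateLabel Y → Bool ⊕ (Y × Bool) ⊕ Bool
  | .const b => .inl b
  | .lit x b => .inr (.inl (x, b))
  | .and => .inr (.inr true)
  | .or => .inr (.inr false)

theorem labelCode_injective {Y : Type*} : Function.Injective (labelCode (Y := Y)) := by
  rintro (_ | _ | _ | _) (_ | _ | _ | _) h <;> simp_all [labelCode]

instance {Y : Type*} [DecidableEq Y] : DecidableEq (GateLabel Y) :=
  labelCode_injective.decidableEq

instance {Y : Type*} (l : GateLabel Y) : Decidable l.IsInput :=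
  match l with
  | .const _ => isTrue trivial
  | .lit _ _ => isTrue trivial
  | .and => isFalse id
  | .or => isFalse id

theorem lt_of_mem_exampleEdges : ∀ g h, (g, h) ∈ exampleEdges → g < h := by
  decide

/-- A normalized DNNF circuit whose constraint matrix is not totally unimodular. -/
def exampleNNF : NNF Bool (Fin 11) where
  graph := ⟨fun g h => (g, h) ∈ exampleEdges⟩
  acyclic g hg := by
    have : ∀ h, Relation.TransGen (fun g h => (g, h) ∈ exampleEdges) g h → g < h := by
      intro h hp
      induction hp with
      | single h => exact lt_of_mem_exampleEdges _ _ h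
      | tail _ h ih => exact ih.trans (lt_of_mem_exampleEdges _ _ h)
    exact lt_irrefl g (this g hg)
  out := 10
  label := exampleLabel
  isInput_iff := by decide

instance (g h : Fin 11) : Decidable (exampleNNF.graph.Adj g h) :=
  inferInstanceAs (Decidable ((g, h) ∈ exampleEdges))

/-- The sets of variables of the gates of `exampleNNF`, as lists. -/
def exampleVars : Fin 11 → List Bool :=
  ![[true], [true], [false], [false], [true], [false], [true, false], [true, false], [true, false],
    [true, false], [true, false]]


instance (g : Fin 11) (l : GateLabel Bool) : Decidable (exampleNNF.label g = l) :=
  inferInstanceAs (Decidable (exampleLabel g = l))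

theorem vars_exampleNNF (g : Fin 11) : exampleNNF.vars g = {x | x ∈ exampleVars g} := by
  refine exampleNNF.vars_eq_of_forall (fun g => {x | x ∈ exampleVars g}) ?_ g
  simp only [Set.mem_ofPred_eq]
  decide

theorem isDNNF_exampleNNF : exampleNNF.IsDNNF := by
  intro g hg h h' hh hh' hne
  rw [vars_exampleNNF, vars_exampleNNF, Set.disjoint_left]
  simp only [Set.mem_ofPred_eq]
  revert g h h'
  decide

theorem isNormalized_exampleNNF : exampleNNF.IsNormalized where
  smooth := by
    intro g hg h hh
    rw [vars_exampleNNF, vars_exampleNNF, Set.ext_iff]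
    simp only [Set.mem_ofPred_eq]
    revert g h
    decide
  out_or := rfl
  out_sink := by decide
  reaches_out g := by
    have key : ∀ g : Fin 11, g ≠ 10 → ∃ h, exampleNNF.graph.Adj g h := by decide
    induction g using exampleNNF.wellFounded_adj_swap.induction with
    | _ g ih =>
      by_cases hg : g = 10
      · subst hg; exact .refl
      · obtain ⟨h, hh⟩ := key g hg
        exact .head hh (ih h hh)
  lit_unique := by decide

/-- Rows of the constraint matrix of `exampleNNF` that form a cycle. -/
def exampleRows : Fin 7 → Row exampleNNF :=
  ![.and ⟨4, 6, by decide⟩ rfl, .or 4 rfl (by decide), .and ⟨4, 7, by decide⟩ rfl,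
    .or 9 rfl (by decide), .and ⟨5, 8, by decide⟩ rfl, .or 5 rfl (by decide),
    .and ⟨5, 6, by decide⟩ rfl]

def exampleCols : Fin 7 → Edge exampleNNF :=
  ![⟨4, 6, by decide⟩, ⟨4, 7, by decide⟩, ⟨7, 9, by decide⟩, ⟨8, 9, by decide⟩, ⟨5, 8, by decide⟩,
    ⟨5, 6, by decide⟩, ⟨6, 10, by decide⟩]

theorem sysMatrix_submatrix_example :
    exampleNNF.sysMatrix.submatrix exampleRows exampleCols =
      !![1, 0, 0, 0, 0, 0, -1;
         -1, -1, 0, 0, 0, 0, 0;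
         0, 1, -1, 0, 0, 0, 0;
         0, 0, 1, 1, 0, 0, 0;
         0, 0, 0, -1, 1, 0, 0;
         0, 0, 0, 0, -1, -1, 0;
         0, 0, 0, 0, 0, 1, -1] := by
  ext i j
  fin_cases i <;> fin_cases j <;>
    simp [sysMatrix, exampleRows, exampleCols, Edge.ext_iff]

theorem not_isTotallyUnimodular_exampleNNF : ¬ exampleNNF.sysMatrix.IsTotallyUnimodular := by
  intro h
  rw [Matrix.isTotallyUnimodular_iff] at h
  obtain ⟨s, hs⟩ := h 7 exampleRows exampleCols
  rw [sysMatrix_submatrix_example] at hs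
  -- Only the diagonal and a 7-cycle, which is an even permutation, contribute; each gives 1, so the
  -- determinant is 2.
  simp [Matrix.det_succ_row_zero, Fin.sum_univ_succ, Fin.succAbove] at hs
  cases s <;> norm_num at hs

end NNF

theorem mainTheorem5 :
    (∀ {X : Type*} {V : Type*} [Finite V] (C : NNF X V), C.IsDNNF →
      IsTDI C.sysMatrix C.sysRhs ∧ IsIntegralPolyhedron C.polyhedron) ∧
    (∃ (X V : Type) (_ : Finite V) (C : NNF X V), C.IsDNNF ∧ C.IsNormalized ∧
      ¬ C.sysMatrix.IsTotallyUnimodular) :=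
  ⟨fun C _ => ⟨C.isTDI_sys, C.isIntegralPolyhedron_polyhedron⟩,
    Bool, Fin 11, inferInstance, NNF.exampleNNF, NNF.isDNNF_exampleNNF,
    NNF.isNormalized_exampleNNF, NNF.not_isTotallyUnimodular_exampleNNF⟩
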